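/- Call a function $\varphi\colon R\setminus\{0\}\to I$ from the nonzero elements of an integral domain $R$ to a totally ordered set $(I,<)$ a Euclidean norm if for all $a,b\in R$ with $b\neq 0$ and $b\nmid a$ there is some $q\in R$ with $\varphi(a-qb)<\varphi(b)$. A Euclidean domain is an integral domain that has a Euclidean norm with values in $(\mathbb{N},<)$. A multiplicative Euclidean norm to a totally ordered monoid $(M,\cdot,1,\le)$ is a Euclidean norm $\psi\colon R\setminus\{0\}\to M$ whose image is contained in a well-ordered subset of $M$ and which satisfies $\psi(ab)=\psi(a)\psi(b)$ for all $a,b\in R\setminus\{0\}$. The order of $M$ is compatible if $a\le b$ implies $ac\le bc$ for all $a,b,c\in M$. **Theorem.** There exists a Euclidean domain $R$ that has no multiplicative Euclidean norm to any compatibly totally ordered monoid $M$ (with image in a well-ordered subset of $M$); in particular, it has none to any compatibly well-ordered monoid. Moreover, $R$ has no multiplicative Euclidean norm with values in a well-ordered subset of $\mathbb{R}$, where $\mathbb{R}$ carries its usual multiplication and order. -/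

import Mathlib

universe u v

/-- A Euclidean norm on a ring `R` (used for integral domains) with values in an ordered set `I`:
a function `φ` on `R - {0}` such that for all `a` and all `b ≠ 0` with `b ∤ a` there is some `q`
with `φ (a - q * b) < φ b`. (The remainder `a - q * b` is nonzero, as `b ∤ a`; the witness `hr`
only serves to make it an element of `R - {0}`.) -/
def IsEuclideanNorm {R : Type u} [CommRing R] {I : Type v} [LT I]
    (φ : {r : R // r ≠ 0} → I) : Prop :=
  ∀ (a b : R) (hb : b ≠ 0), ¬ b ∣ a →
    ∃ (q : R) (hr : a - q * b ≠ 0), φ ⟨a - q * b, hr⟩ < φ ⟨b, hb⟩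

/-- A multiplicative Euclidean norm on an integral domain `R` with values in a well-ordered subset
of a totally ordered monoid `M`. No relation between the order and the multiplication of `M` is
assumed here. If `M` itself is well-ordered, then the second field is automatic. -/
structure IsMultiplicativeEuclideanNorm {R : Type u} [CommRing R] [IsDomain R]
    {M : Type v} [Monoid M] [LinearOrder M] (φ : {r : R // r ≠ 0} → M) : Prop where
  isEuclideanNorm : IsEuclideanNorm φ
  range_isWF : (Set.range φ).IsWF
  map_mul : ∀ a b : {r : R // r ≠ 0},
    φ ⟨(a : R) * (b : R), mul_ne_zero a.2 b.2⟩ = φ a * φ b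

/-! ### A ring-theoretic obstruction to multiplicative norms -/

section Criterion

variable {R : Type u} [CommRing R]

/-! Obstruction (`false_of_avoided_classes`): a nonunit z of least value is irreducible, and all its
nonzero residue classes contain units; avoided classes thus force z into W. Let b have least value
among z² and the irreducibles outside W. In an avoided class modulo b, division leaves a nonzero
nonunit r outside W with ψ(r) < ψ(b). So r is reducible, and compatibility gives ψ(r) ≥ ψ(z)² ≥
ψ(b), a contradiction.

Construction: localize a polynomial ring, with W the associates of the small variables X₀, X₁ of all
blocks. For coprime (a, b), inverting A = bX₃ + aX₂ and B = bX₄ + X₀X₁X₂ in fresh variables gives a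
≡ X₀X₁A/B modulo b. If b is a product of distinct small variables, inverting bX₅ + a even gives a
unit remainder. In `size`, two new small primes cost 2, whereas a b that is not, up to inverted
factors, a product of distinct small primes costs at least 3. Hence the ring is Euclidean
(`isEuclideanNorm_locSize`).

Avoided classes (`not_pow_dvd_sub`): let p^k divide no product of distinct small variables, with p
prime and not inverted. Each polynomial inverted late has a fresh variable in which its derivative
is nonzero modulo p^k, so it cannot help make a late X₆ congruent to a unit or a small prime. -/

theorem exists_minimal_value {M : Type v} [LinearOrder M] {ψ : {r : R // r ≠ 0} → M}
    (hψ : (Set.range ψ).IsWF) (P : R → Prop) (hP : ∃ r, r ≠ 0 ∧ P r) :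
    ∃ x : {r : R // r ≠ 0}, P x ∧ ∀ y : {r : R // r ≠ 0}, P y → ψ x ≤ ψ y := by
  obtain ⟨r, hr, hPr⟩ := hP
  have hsub : (ψ '' {x | P x}).IsWF := hψ.mono (Set.image_subset_range _ _)
  have hne : (ψ '' {x | P x}).Nonempty := ⟨_, ⟨r, hr⟩, hPr, rfl⟩
  obtain ⟨x, hx, hxe⟩ := hsub.min_mem hne
  refine ⟨x, hx, fun y hy => ?_⟩
  rw [hxe]
  exact hsub.min_le hne ⟨y, hy, rfl⟩

namespace IsMultiplicativeEuclideanNorm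

variable [IsDomain R] {M : Type v} [Monoid M] [LinearOrder M] {ψ : {r : R // r ≠ 0} → M}

theorem map_eq_mul (h : IsMultiplicativeEuclideanNorm ψ) {a b c : {r : R // r ≠ 0}}
    (hc : (c : R) = a * b) : ψ c = ψ a * ψ b := by
  rw [← h.map_mul]
  exact congrArg ψ (Subtype.ext hc)

/-- If every irreducible outside `W` and every square of an element of `W` has a residue class
without `0`, units and elements of `W`, then there is no multiplicative Euclidean norm to a
compatibly ordered monoid. -/
theorem false_of_avoided_classes (h : IsMultiplicativeEuclideanNorm ψ)
    (hM : ∀ a b c : M, a ≤ b → a * c ≤ b * c) (W : Set R)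
    (hfield : ∃ t : R, t ≠ 0 ∧ ¬ IsUnit t)
    (hW : ∀ b : R, (Irreducible b ∧ b ∉ W) ∨ (∃ w ∈ W, b = w ^ 2) →
      ∃ a, ∀ r, b ∣ a - r → r ≠ 0 ∧ ¬ IsUnit r ∧ r ∉ W) : False := by
  -- `M` need not be commutative, but the values of `ψ` commute, so one-sided compatibility
  -- suffices.
  have hM' : ∀ a b c d : {r : R // r ≠ 0}, ψ a ≤ ψ b → ψ c ≤ ψ d → ψ a * ψ c ≤ ψ b * ψ d := by
    intro a b c d hab hcd
    have hcomm : ∀ a b : {r : R // r ≠ 0}, ψ a * ψ b = ψ b * ψ a := fun a b => by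
      rw [← h.map_mul]
      exact h.map_eq_mul (mul_comm _ _)
    calc ψ a * ψ c ≤ ψ b * ψ c := hM _ _ _ hab
      _ = ψ c * ψ b := hcomm _ _
      _ ≤ ψ d * ψ b := hM _ _ _ hcd
      _ = ψ b * ψ d := hcomm _ _
  obtain ⟨z, hz, hzmin⟩ := exists_minimal_value h.range_isWF (fun r => ¬ IsUnit r) hfield
  have hzunit : ∀ a : R, ¬ (z : R) ∣ a → ∃ r, IsUnit r ∧ (z : R) ∣ a - r := by
    intro a ha
    obtain ⟨q, hr, hlt⟩ := h.isEuclideanNorm a z z.2 ha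
    refine ⟨a - q * z, ?_, ⟨q, by ring⟩⟩
    by_contra hnu
    exact absurd (hzmin ⟨_, hr⟩ hnu) (not_le.2 hlt)
  have hzirr : Irreducible (z : R) := by
    refine ⟨hz, fun x y hxy => ?_⟩
    by_cases hzx : (z : R) ∣ x
    · right
      obtain ⟨k, hk⟩ := hzx
      refine IsUnit.of_mul_eq_one k (mul_left_cancel₀ z.2 ?_)
      rw [mul_one]
      conv_rhs => rw [hxy, hk]
      ring
    · left
      obtain ⟨r, hr, hzr⟩ := hzunit x hzx
      -- As x divides z, it divides x - r and hence the unit r.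
      have hxr : x ∣ r := by
        have h1 : x ∣ x - r := (Dvd.intro _ hxy.symm).trans hzr
        simpa using (dvd_sub_self_left.1 h1)
      exact isUnit_of_dvd_unit hxr hr
  have hzW : (z : R) ∈ W := by
    by_contra hzW
    obtain ⟨a, ha⟩ := hW z (Or.inl ⟨hzirr, hzW⟩)
    have hza : ¬ (z : R) ∣ a := fun hza => (ha 0 (by simpa using hza)).1 rfl
    obtain ⟨r, hr, hzr⟩ := hzunit a hza
    exact (ha r hzr).2.1 hr
  obtain ⟨b, hb, hbmin⟩ := exists_minimal_value h.range_isWF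
    (fun r => (Irreducible r ∧ r ∉ W) ∨ r = (z : R) ^ 2) ⟨(z : R) ^ 2, pow_ne_zero 2 z.2, Or.inr rfl⟩
  obtain ⟨a, ha⟩ := hW b (hb.imp_right fun hb => ⟨z, hzW, hb⟩)
  have hba : ¬ (b : R) ∣ a := fun hba => (ha 0 (by simpa using hba)).1 rfl
  obtain ⟨q, hr, hlt⟩ := h.isEuclideanNorm a b b.2 hba
  obtain ⟨-, hru, hrW⟩ := ha (a - q * b) ⟨q, by ring⟩
  have hrirr : ¬ Irreducible (a - q * b) := fun hirr =>
    absurd (hbmin ⟨_, hr⟩ (Or.inl ⟨hirr, hrW⟩)) (not_le.2 hlt)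
  rw [irreducible_iff] at hrirr
  push Not at hrirr
  obtain ⟨x, y, hxy, hx, hy⟩ := hrirr hru
  have hx0 : x ≠ 0 := by
    rintro rfl
    exact hr (by rw [hxy, zero_mul])
  have hy0 : y ≠ 0 := by
    rintro rfl
    exact hr (by rw [hxy, mul_zero])
  have h1 : ψ ⟨a - q * b, hr⟩ = ψ ⟨x, hx0⟩ * ψ ⟨y, hy0⟩ := h.map_eq_mul hxy
  have h2 : ψ ⟨(z : R) ^ 2, pow_ne_zero 2 z.2⟩ = ψ z * ψ z := h.map_eq_mul (sq _)
  have h3 := hbmin ⟨(z : R) ^ 2, pow_ne_zero 2 z.2⟩ (Or.inr rfl)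
  have h4 := hM' z ⟨x, hx0⟩ z ⟨y, hy0⟩ (hzmin _ hx) (hzmin _ hy)
  rw [h1] at hlt
  rw [h2] at h3
  exact absurd (h3.trans h4) (not_le.2 hlt)

/-- The minima of `ψ` on the ideals (t^n) increase strictly, because dividing t^n by a minimizer for
n + 1 leaves a remainder in (t^n). Multiplication by a negative value would turn them into an
infinite descent. -/
theorem nonneg_of_real {ψ : {r : R // r ≠ 0} → ℝ} (h : IsMultiplicativeEuclideanNorm ψ)
    (hfield : ∃ t : R, t ≠ 0 ∧ ¬ IsUnit t) (r : {r : R // r ≠ 0}) : 0 ≤ ψ r := by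
  by_contra! hneg
  obtain ⟨t, ht0, ht⟩ := hfield
  have hmin : ∀ n : ℕ, ∃ x : {r : R // r ≠ 0}, t ^ n ∣ (x : R) ∧
      ∀ y : {r : R // r ≠ 0}, t ^ n ∣ (y : R) → ψ x ≤ ψ y := fun n =>
    exists_minimal_value h.range_isWF (fun r => t ^ n ∣ r) ⟨t ^ n, pow_ne_zero n ht0, dvd_rfl⟩
  choose x hx hxmin using hmin
  have hmono : StrictMono fun n => ψ (x n) := by
    refine strictMono_nat_of_lt_succ fun n => ?_
    have hnd : ¬ ((x (n + 1) : {r : R // r ≠ 0}) : R) ∣ t ^ n := fun hd => by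
      have h1 : t ^ n * t ∣ t ^ n * 1 := by
        rw [← pow_succ, mul_one]
        exact (hx (n + 1)).trans hd
      exact ht (isUnit_of_dvd_one ((mul_dvd_mul_iff_left (pow_ne_zero n ht0)).1 h1))
    obtain ⟨q, hr, hlt⟩ := h.isEuclideanNorm (t ^ n) (x (n + 1)) (x (n + 1)).2 hnd
    refine lt_of_le_of_lt (hxmin n ⟨_, hr⟩ ?_) hlt
    exact dvd_sub dvd_rfl (Dvd.dvd.mul_left ((pow_dvd_pow t n.le_succ).trans (hx (n + 1))) q)
  have hanti : StrictAnti fun n => ψ r * ψ (x n) := fun m n hmn =>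
    mul_lt_mul_of_neg_left (hmono hmn) hneg
  refine (Set.isWF_iff_no_descending_seq.1 h.range_isWF) _ hanti fun n => ?_
  exact ⟨_, h.map_mul r (x n)⟩

/-- The order of ℝ is not compatible with multiplication; that of `NNReal` is, and the values lie
there. -/
theorem real_false_of_avoided_classes {ψ : {r : R // r ≠ 0} → ℝ}
    (h : IsMultiplicativeEuclideanNorm ψ) (W : Set R)
    (hfield : ∃ t : R, t ≠ 0 ∧ ¬ IsUnit t)
    (hW : ∀ b : R, (Irreducible b ∧ b ∉ W) ∨ (∃ w ∈ W, b = w ^ 2) →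
      ∃ a, ∀ r, b ∣ a - r → r ≠ 0 ∧ ¬ IsUnit r ∧ r ∉ W) : False := by
  let ψ' : {r : R // r ≠ 0} → NNReal := fun r => ⟨ψ r, h.nonneg_of_real hfield r⟩
  have h' : IsMultiplicativeEuclideanNorm ψ' := by
    refine ⟨fun a b hb hab => ?_, ?_, fun a b => NNReal.eq (h.map_mul a b)⟩
    · obtain ⟨q, hr, hlt⟩ := h.isEuclideanNorm a b hb hab
      exact ⟨q, hr, hlt⟩
    · rw [Set.isWF_iff_no_descending_seq]
      intro f hf hmem
      refine (Set.isWF_iff_no_descending_seq.1 h.range_isWF) (fun n => (f n : ℝ))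
        (fun m n hmn => hf hmn) fun n => ?_
      obtain ⟨r, hr⟩ := hmem n
      exact ⟨r, by rw [← hr]; rfl⟩
  exact h'.false_of_avoided_classes (fun a b c hab => mul_le_mul_left hab c) W hfield hW

end IsMultiplicativeEuclideanNorm
end Criterion

/-! ### Blocks of variables and the sequence of tasks -/

/-- The polynomial ring whose localization is the Euclidean domain: the variables come in blocks
of seven, indexed by `ℕ`. -/
abbrev BlockPoly : Type := MvPolynomial (ℕ × Fin 7) ℚ

namespace BlockPoly

open MvPolynomial

/-- The variables that become the small primes. -/
def IsSmall (v : ℕ × Fin 7) : Prop := v.2 = 0 ∨ v.2 = 1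

/-- Products of distinct small primes. -/
def IsSmallProduct (b : BlockPoly) : Prop :=
  ∃ J : Finset (ℕ × Fin 7), (∀ v ∈ J, IsSmall v) ∧ b = ∏ v ∈ J, X v

/-- A sequence running infinitely often through all pairs of relatively prime polynomials with
nonzero second entry, such that the `n`-th pair only uses variables from the blocks before `n`. -/
structure IsTaskSequence (c : ℕ → BlockPoly × BlockPoly) : Prop where
  ne_zero : ∀ n, (c n).2 ≠ 0
  isRelPrime : ∀ n, IsRelPrime (c n).1 (c n).2
  fst_lt : ∀ n, ∀ v ∈ (c n).1.vars, v.1 < n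
  snd_lt : ∀ n, ∀ v ∈ (c n).2.vars, v.1 < n
  exhaustive : ∀ a b : BlockPoly, b ≠ 0 → IsRelPrime a b → ∀ N, ∃ n, N ≤ n ∧ c n = (a, b)

theorem exists_vars_lt (f : BlockPoly) : ∃ N, ∀ v ∈ f.vars, v.1 < N :=
  ⟨f.vars.sup Prod.fst + 1, fun _ hv => Nat.lt_succ_of_le (Finset.le_sup (f := Prod.fst) hv)⟩

instance : Countable BlockPoly := by
  rw [← Cardinal.mk_le_aleph0_iff]
  refine (MvPolynomial.cardinalMk_le_max (σ := ℕ × Fin 7) (R := ℚ)).trans ?_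
  simp

/-- Unpairing repeats every pair infinitely often; (1, 1) fills the places where the pair is not
admissible. -/
theorem exists_isTaskSequence : ∃ c, IsTaskSequence c := by
  classical
  obtain ⟨g, hg⟩ := exists_surjective_nat (BlockPoly × BlockPoly)
  let ok : ℕ → BlockPoly × BlockPoly → Prop := fun n x =>
    x.2 ≠ 0 ∧ IsRelPrime x.1 x.2 ∧ (∀ v ∈ x.1.vars, v.1 < n) ∧ ∀ v ∈ x.2.vars, v.1 < n
  have hone : ∀ n, ok n (1, 1) := fun n => ⟨one_ne_zero, isRelPrime_one_left, by simp, by simp⟩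
  let c : ℕ → BlockPoly × BlockPoly := fun n =>
    if ok n (g n.unpair.1) then g n.unpair.1 else (1, 1)
  have hc : ∀ n, ok n (c n) := fun n => by
    by_cases h : ok n (g n.unpair.1)
    · simp only [c, if_pos h]
      exact h
    · simp only [c, if_neg h]
      exact hone n
  refine ⟨c, fun n => (hc n).1, fun n => (hc n).2.1, fun n => (hc n).2.2.1,
    fun n => (hc n).2.2.2, fun a b hb hab N => ?_⟩
  obtain ⟨k, hk⟩ := hg (a, b)
  obtain ⟨N₁, h₁⟩ := exists_vars_lt a
  obtain ⟨N₂, h₂⟩ := exists_vars_lt b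
  have hle := Nat.right_le_pair k (N + N₁ + N₂)
  refine ⟨Nat.pair k (N + N₁ + N₂), by omega, ?_⟩
  have hok : ok (Nat.pair k (N + N₁ + N₂)) (g (Nat.pair k (N + N₁ + N₂)).unpair.1) := by
    rw [Nat.unpair_pair, hk]
    exact ⟨hb, hab, fun v hv => by have := h₁ v hv; omega, fun v hv => by have := h₂ v hv; omega⟩
  simp only [c, if_pos hok]
  rw [Nat.unpair_pair, hk]

theorem not_X_dvd {v : ℕ × Fin 7} {b : BlockPoly} (hb : b ≠ 0) (hv : v ∉ b.vars) : ¬ X v ∣ b := by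
  intro hd
  -- Setting the absent variable to 0 fixes b but kills every multiple of it.
  have h1 : aeval (Function.update X v (0 : BlockPoly)) b = aeval (X : _ → BlockPoly) b := by
    refine eval₂Hom_congr' rfl (fun i hi _ => ?_) rfl
    rw [Function.update_of_ne]
    rintro rfl
    exact hv hi
  rw [aeval_X_left_apply] at h1
  obtain ⟨q, rfl⟩ := hd
  rw [map_mul, aeval_X, Function.update_self, zero_mul] at h1
  exact hb h1.symm

/-! ### The inverted polynomials -/

/-- The first polynomial of step `n` to be inverted. -/
noncomputable def unitA (c : ℕ → BlockPoly × BlockPoly) (n : ℕ) : BlockPoly :=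
  (c n).2 * X (n, 3) + (c n).1 * X (n, 2)

/-- The second polynomial of step `n` to be inverted. -/
noncomputable def unitB (c : ℕ → BlockPoly × BlockPoly) (n : ℕ) : BlockPoly :=
  (c n).2 * X (n, 4) + X (n, 0) * X (n, 1) * X (n, 2)

open Classical in
/-- The third polynomial of step `n` to be inverted. -/
noncomputable def unitC (c : ℕ → BlockPoly × BlockPoly) (n : ℕ) : BlockPoly :=
  if IsSmallProduct (c n).2 then (c n).2 * X (n, 5) + (c n).1 else 1

/-- The polynomials that are inverted before step `n`. -/
noncomputable def stage (c : ℕ → BlockPoly × BlockPoly) : ℕ → Submonoid BlockPoly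
  | 0 => IsUnit.submonoid BlockPoly
  | n + 1 => stage c n ⊔ Submonoid.powers (unitA c n) ⊔ Submonoid.powers (unitB c n) ⊔
      Submonoid.powers (unitC c n)

/-- The polynomials that are inverted. -/
noncomputable def inverted (c : ℕ → BlockPoly × BlockPoly) : Submonoid BlockPoly :=
  ⨆ n, stage c n

variable {c : ℕ → BlockPoly × BlockPoly}

theorem stage_le_succ (n : ℕ) : stage c n ≤ stage c (n + 1) :=
  (le_sup_left.trans le_sup_left).trans le_sup_left

theorem stage_mono : Monotone (stage c) := monotone_nat_of_le_succ stage_le_succ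

theorem mem_inverted {f : BlockPoly} : f ∈ inverted c ↔ ∃ n, f ∈ stage c n :=
  Submonoid.mem_iSup_of_directed stage_mono.directed_le

theorem unitA_mem (n : ℕ) : unitA c n ∈ inverted c :=
  mem_inverted.2 ⟨n + 1, (((le_sup_right : Submonoid.powers (unitA c n) ≤ _).trans
    le_sup_left).trans le_sup_left) (Submonoid.mem_powers _)⟩

theorem unitB_mem (n : ℕ) : unitB c n ∈ inverted c :=
  mem_inverted.2 ⟨n + 1, ((le_sup_right : Submonoid.powers (unitB c n) ≤ _).trans
    le_sup_left) (Submonoid.mem_powers _)⟩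

theorem unitC_mem (n : ℕ) : unitC c n ∈ inverted c :=
  mem_inverted.2 ⟨n + 1, (le_sup_right : Submonoid.powers (unitC c n) ≤ _)
    (Submonoid.mem_powers _)⟩

theorem isUnit_mem {f : BlockPoly} (hf : IsUnit f) : f ∈ inverted c :=
  mem_inverted.2 ⟨0, hf⟩

/-- Induction over the inverted polynomials. -/
theorem inverted_induction {P : BlockPoly → Prop} (hunit : ∀ f, IsUnit f → P f)
    (hmul : ∀ f g, P f → P g → P (f * g)) (hA : ∀ n, P (unitA c n)) (hB : ∀ n, P (unitB c n))
    (hC : ∀ n, P (unitC c n)) {f : BlockPoly} (hf : f ∈ inverted c) : P f := by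
  let T : Submonoid BlockPoly :=
    { carrier := {f | P f}
      mul_mem' := fun hf hg => hmul _ _ hf hg
      one_mem' := hunit 1 isUnit_one }
  have : ∀ n, stage c n ≤ T := fun n => by
    induction n with
    | zero => exact fun f hf => hunit f hf
    | succ n ih =>
      refine sup_le (sup_le (sup_le ih ?_) ?_) ?_ <;> rw [Submonoid.powers_le]
      exacts [hA n, hB n, hC n]
  obtain ⟨n, hn⟩ := mem_inverted.1 hf
  exact this n hn

theorem pderiv_X_eq_zero {v w : ℕ × Fin 7} (h : w ≠ v) : pderiv v (X w : BlockPoly) = 0 :=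
  pderiv_X_of_ne h

namespace IsTaskSequence

theorem notMem_fst (hc : IsTaskSequence c) {n : ℕ} {v : ℕ × Fin 7} (hv : n ≤ v.1) :
    v ∉ (c n).1.vars := fun h => absurd (hc.fst_lt n v h) (not_lt.2 hv)

theorem notMem_snd (hc : IsTaskSequence c) {n : ℕ} {v : ℕ × Fin 7} (hv : n ≤ v.1) :
    v ∉ (c n).2.vars := fun h => absurd (hc.snd_lt n v h) (not_lt.2 hv)

theorem pderiv_fst (hc : IsTaskSequence c) {n : ℕ} {v : ℕ × Fin 7} (hv : n ≤ v.1) :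
    pderiv v (c n).1 = 0 := pderiv_eq_zero_of_notMem_vars (hc.notMem_fst hv)

theorem pderiv_snd (hc : IsTaskSequence c) {n : ℕ} {v : ℕ × Fin 7} (hv : n ≤ v.1) :
    pderiv v (c n).2 = 0 := pderiv_eq_zero_of_notMem_vars (hc.notMem_snd hv)

theorem isRelPrime_X (hc : IsTaskSequence c) {n : ℕ} {v : ℕ × Fin 7} (hv : n ≤ v.1) :
    IsRelPrime (c n).2 (X v) :=
  (((X_prime (i := v) (R := ℚ)).irreducible.isRelPrime_iff_not_dvd).2
    (not_X_dvd (hc.ne_zero n) (hc.notMem_snd hv))).symm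

theorem irreducible_unitA (hc : IsTaskSequence c) (n : ℕ) : Irreducible (unitA c n) := by
  classical
  refine irreducible_mul_X_add _ _ _ (hc.ne_zero n) (hc.notMem_snd le_rfl) ?_ ?_
  · intro h
    rcases Finset.mem_union.1 (vars_mul _ _ h) with h | h
    · exact hc.notMem_fst le_rfl h
    · simp [vars_X] at h
  · exact IsRelPrime.mul_right (hc.isRelPrime n).symm (hc.isRelPrime_X le_rfl)

theorem irreducible_unitB (hc : IsTaskSequence c) (n : ℕ) : Irreducible (unitB c n) := by
  classical
  refine irreducible_mul_X_add _ _ _ (hc.ne_zero n) (hc.notMem_snd le_rfl) ?_ ?_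
  · intro h
    rcases Finset.mem_union.1 (vars_mul _ _ h) with h | h
    · rcases Finset.mem_union.1 (vars_mul _ _ h) with h | h <;> simp [vars_X] at h
    · simp [vars_X] at h
  · exact IsRelPrime.mul_right (IsRelPrime.mul_right (hc.isRelPrime_X le_rfl)
      (hc.isRelPrime_X le_rfl)) (hc.isRelPrime_X le_rfl)

theorem irreducible_unitC (hc : IsTaskSequence c) (n : ℕ) :
    unitC c n = 1 ∨ Irreducible (unitC c n) := by
  unfold unitC
  split_ifs with h
  · right
    exact irreducible_mul_X_add _ _ _ (hc.ne_zero n) (hc.notMem_snd le_rfl) (hc.notMem_fst le_rfl)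
      (hc.isRelPrime n).symm
  · exact Or.inl rfl

/-- The generators are irreducible or 1, so the inverted set is saturated. -/
theorem mem_inverted_of_dvd (hc : IsTaskSequence c) {s : BlockPoly} (hs : s ∈ inverted c) :
    ∀ f, f ∣ s → f ∈ inverted c := by
  have hirr : ∀ u : BlockPoly, u ∈ inverted c → Irreducible u → ∀ f, f ∣ u → f ∈ inverted c := by
    intro u hu hirr f hf
    rcases hirr.dvd_iff.1 hf with h | h
    · exact isUnit_mem h
    · obtain ⟨ε, hε⟩ := h
      rw [← hε]
      exact mul_mem hu (isUnit_mem ε.isUnit)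
  refine inverted_induction (P := fun s => ∀ f, f ∣ s → f ∈ inverted c) ?_ ?_ ?_ ?_ ?_ hs
  · exact fun s hs f hf => isUnit_mem (isUnit_of_dvd_unit hf hs)
  · intro s t hs ht f hf
    obtain ⟨f₁, f₂, h₁, h₂, rfl⟩ := exists_dvd_and_dvd_of_dvd_mul hf
    exact mul_mem (hs _ h₁) (ht _ h₂)
  · exact fun n => hirr _ (unitA_mem n) (hc.irreducible_unitA n)
  · exact fun n => hirr _ (unitB_mem n) (hc.irreducible_unitB n)
  · intro n
    rcases hc.irreducible_unitC n with h | h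
    · rw [h]
      exact fun f hf => isUnit_mem (isUnit_of_dvd_one hf)
    · exact hirr _ (unitC_mem n) h

theorem ne_zero_of_mem (hc : IsTaskSequence c) {s : BlockPoly} (hs : s ∈ inverted c) : s ≠ 0 := by
  refine inverted_induction (P := fun s => s ≠ 0) (fun _ h => h.ne_zero)
    (fun _ _ => mul_ne_zero) (fun n => (hc.irreducible_unitA n).ne_zero)
    (fun n => (hc.irreducible_unitB n).ne_zero) (fun n => ?_) hs
  rcases hc.irreducible_unitC n with h | h
  · rw [h]
    exact one_ne_zero
  · exact h.ne_zero

theorem not_dvd_both (hc : IsTaskSequence c) {p : BlockPoly} (hp : Prime p) {n : ℕ}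
    (h : p ∣ (c n).2) : ¬ p ∣ (c n).1 := fun h' => hp.not_isUnit (hc.isRelPrime n h' h)

theorem small_not_dvd (hc : IsTaskSequence c) {v : ℕ × Fin 7} (hv : IsSmall v) {s : BlockPoly}
    (hs : s ∈ inverted c) : ¬ X v ∣ s := by
  have hp : Prime (X v : BlockPoly) := X_prime
  have hne : ∀ (n : ℕ) (i : Fin 7), i ≠ 0 → i ≠ 1 → ¬ (X v : BlockPoly) ∣ X (n, i) := by
    intro n i h0 h1 h
    rw [X_dvd_X] at h
    subst h
    rcases hv with h | h
    · exact h0 h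
    · exact h1 h
  have hcop : ∀ (n : ℕ) (i : Fin 7) (f : BlockPoly), i ≠ 0 → i ≠ 1 →
      pderiv (n, i) f = 0 → X v ∣ (c n).2 * X (n, i) + f → X v ∣ (c n).2 ∧ X v ∣ f := by
    rintro n i f h0 h1 hf ⟨q, hq⟩
    have hvi : v ≠ (n, i) := by
      rintro rfl
      exact hne n i h0 h1 dvd_rfl
    -- Differentiating in the fresh variable isolates the coefficient `(c n).2`.
    have hD := congrArg (pderiv (n, i)) hq
    rw [map_add, pderiv_mul, pderiv_mul, hc.pderiv_snd le_rfl, pderiv_X_self, hf,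
      pderiv_X_eq_zero hvi, zero_mul, zero_mul, zero_add, zero_add, add_zero, mul_one] at hD
    have h2 : X v ∣ (c n).2 := ⟨_, hD⟩
    exact ⟨h2, (dvd_add_right (h2.mul_right _)).1 ⟨q, hq⟩⟩
  refine inverted_induction (P := fun s => ¬ X v ∣ s) (fun f hf h => ?_)
    (fun f g hf hg h => (hp.dvd_or_dvd h).elim hf hg) (fun n h => ?_) (fun n h => ?_)
    (fun n h => ?_) hs
  · exact hp.not_isUnit (isUnit_of_dvd_unit h hf)
  · obtain ⟨h1, h2⟩ := hcop n 3 _ (by decide) (by decide)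
      (by rw [pderiv_mul, hc.pderiv_fst le_rfl, pderiv_X_eq_zero (by simp)]; simp) h
    exact (hp.dvd_or_dvd h2).elim (hc.not_dvd_both hp h1) (hne _ _ (by decide) (by decide))
  · obtain ⟨h1, h2⟩ := hcop n 4 _ (by decide) (by decide)
      (by rw [pderiv_mul, pderiv_mul, pderiv_X_eq_zero (by simp), pderiv_X_eq_zero (by simp),
            pderiv_X_eq_zero (by simp)]; simp) h
    have hblock : ∀ i, ¬ (X v : BlockPoly) ∣ X (n, i) := by
      intro i hi
      rw [X_dvd_X] at hi
      subst hi
      exact not_X_dvd (hc.ne_zero n) (hc.notMem_snd le_rfl) h1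
    rcases hp.dvd_or_dvd h2 with h2 | h2
    · exact (hp.dvd_or_dvd h2).elim (hblock _) (hblock _)
    · exact hblock _ h2
  · unfold unitC at h
    split_ifs at h
    · obtain ⟨h1, h2⟩ := hcop n 5 _ (by decide) (by decide) (hc.pderiv_fst le_rfl) h
      exact hc.not_dvd_both hp h1 h2
    · exact hp.not_isUnit (isUnit_of_dvd_one h)

/-- Only blocks before n occur in stage n; vanishing derivatives express this in a form closed under
products. -/
theorem pderiv_stage (hc : IsTaskSequence c) {n : ℕ} {v : ℕ × Fin 7} (hv : n ≤ v.1) :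
    ∀ f ∈ stage c n, pderiv v f = 0 := by
  let T : Submonoid BlockPoly :=
    { carrier := {f | pderiv v f = 0}
      mul_mem' := fun {f g} hf hg => by
        change pderiv v (f * g) = 0
        rw [pderiv_mul, show pderiv v f = 0 from hf, show pderiv v g = 0 from hg]
        simp
      one_mem' := pderiv_one }
  change stage c n ≤ T
  induction n with
  | zero =>
    intro f hf
    obtain ⟨r, -, rfl⟩ := (MvPolynomial.isUnit_iff_eq_C_of_isReduced (P := f)).1 hf
    exact pderiv_C
  | succ n ih =>
    have hne : ∀ i, (n, i) ≠ v := by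
      rintro i rfl
      simp at hv
    refine sup_le (sup_le (sup_le (ih (by omega)) ?_) ?_) ?_ <;> rw [Submonoid.powers_le]
    · change pderiv v (unitA c n) = 0
      simp only [unitA, map_add, pderiv_mul, hc.pderiv_fst (Nat.le_of_succ_le hv),
        hc.pderiv_snd (Nat.le_of_succ_le hv), pderiv_X_eq_zero (hne _)]
      simp
    · change pderiv v (unitB c n) = 0
      simp only [unitB, map_add, pderiv_mul, hc.pderiv_snd (Nat.le_of_succ_le hv),
        pderiv_X_eq_zero (hne _)]
      simp
    · change pderiv v (unitC c n) = 0
      unfold unitC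
      split_ifs
      · simp only [map_add, pderiv_mul, hc.pderiv_fst (Nat.le_of_succ_le hv),
          hc.pderiv_snd (Nat.le_of_succ_le hv), pderiv_X_eq_zero (hne _)]
        simp
      · exact pderiv_one

end IsTaskSequence

/-! ### Unsolvable congruences by differentiation -/

theorem pow_dvd_pderiv {p f : BlockPoly} {k : ℕ} {v : ℕ × Fin 7} (hpv : pderiv v p = 0)
    (h : p ^ k ∣ f) : p ^ k ∣ pderiv v f := by
  obtain ⟨q, rfl⟩ := h
  rw [pderiv_mul, pderiv_pow, hpv, mul_zero, zero_mul, zero_add]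
  exact dvd_mul_right _ _

/-- Differentiating x ≡ y u^l leaves l y u^(l-1) ∂u ≡ 0, where p divides none of the factors before
∂u. -/
theorem pow_dvd_pderiv_of_dvd_sub {p x y u : BlockPoly} {k l : ℕ} {v : ℕ × Fin 7} (hp : Prime p)
    (hpv : pderiv v p = 0) (hx : pderiv v x = 0) (hy : pderiv v y = 0) (hpy : ¬ p ∣ y)
    (hpu : ¬ p ∣ u) (hl : l ≠ 0) (h : p ^ k ∣ x - y * u ^ l) : p ^ k ∣ pderiv v u := by
  have h1 := pow_dvd_pderiv hpv h
  rw [map_sub, hx, pderiv_mul, hy, zero_mul, zero_add, zero_sub, dvd_neg, pderiv_pow] at h1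
  have h2 := hp.pow_dvd_of_dvd_mul_left k hpy h1
  refine hp.pow_dvd_of_dvd_mul_left k ?_ h2
  intro h3
  rcases hp.dvd_or_dvd h3 with h3 | h3
  · refine hp.not_isUnit (isUnit_of_dvd_unit h3 ?_)
    have : IsUnit (C (l : ℚ) : BlockPoly) := (IsUnit.mk0 _ (Nat.cast_ne_zero.2 hl)).map C
    simpa using this
  · exact hpu (hp.dvd_of_dvd_pow h3)

/-- The relation `d * g ≡ m * h` modulo `p ^ k` stays unsolvable when the solutions may involve one
more polynomial `u` whose derivative in a fresh variable is nonzero modulo `p ^ k`. -/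
theorem not_pow_dvd_sub_extend {p d m u : BlockPoly} {k : ℕ} {v : ℕ × Fin 7} {S : Submonoid BlockPoly}
    (hp : Prime p) (hpv : pderiv v p = 0) (hd : pderiv v d = 0) (hm : pderiv v m = 0)
    (hS : ∀ g ∈ S, pderiv v g = 0) (hpd : ¬ p ∣ d) (hpm : ¬ p ∣ m) (hpS : ∀ g ∈ S, ¬ p ∣ g)
    (hpu : ¬ p ∣ u) (hu : ¬ p ^ k ∣ pderiv v u)
    (H : ∀ g ∈ S, ∀ h ∈ S, ¬ p ^ k ∣ d * g - m * h) :
    ∀ g ∈ S ⊔ Submonoid.powers u, ∀ h ∈ S ⊔ Submonoid.powers u, ¬ p ^ k ∣ d * g - m * h := by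
  intro g' hg' h' hh' hdvd
  obtain ⟨g, hg, _, ⟨i, rfl⟩, rfl⟩ := Submonoid.mem_sup.1 hg'
  obtain ⟨h, hh, _, ⟨j, rfl⟩, rfl⟩ := Submonoid.mem_sup.1 hh'
  have hmul : ∀ {x y : BlockPoly}, pderiv v x = 0 → pderiv v y = 0 → pderiv v (x * y) = 0 :=
    fun hx hy => by rw [pderiv_mul, hx, hy, zero_mul, mul_zero, add_zero]
  have hcancel : ∀ {i : ℕ} {x : BlockPoly}, p ^ k ∣ u ^ i * x → p ^ k ∣ x := fun hx =>
    hp.pow_dvd_of_dvd_mul_left k (fun h => hpu (hp.dvd_of_dvd_pow h)) hx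
  -- Cancelling the smaller power leaves u on one side only; exponent 0 falls back on `H`.
  rcases le_total i j with hij | hij <;> obtain ⟨l, rfl⟩ := Nat.exists_eq_add_of_le hij
  · have h1 : p ^ k ∣ d * g - m * h * u ^ l := by
      refine hcancel (i := i) ?_
      convert hdvd using 1
      ring
    by_cases hl : l = 0
    · subst hl
      rw [pow_zero, mul_one] at h1
      exact H g hg h hh h1
    · exact hu (pow_dvd_pderiv_of_dvd_sub hp hpv (hmul hd (hS g hg)) (hmul hm (hS h hh))
        (fun h2 => (hp.dvd_or_dvd h2).elim hpm (hpS h hh)) hpu hl h1)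
  · have h1 : p ^ k ∣ m * h - d * g * u ^ l := by
      refine hcancel (i := j) ?_
      rw [← dvd_neg]
      convert hdvd using 1
      ring
    by_cases hl : l = 0
    · subst hl
      rw [pow_zero, mul_one, dvd_sub_comm] at h1
      exact H g hg h hh h1
    · exact hu (pow_dvd_pderiv_of_dvd_sub hp hpv (hmul hm (hS h hh)) (hmul hd (hS g hg))
        (fun h2 => (hp.dvd_or_dvd h2).elim hpd (hpS g hg)) hpu hl h1)

namespace IsTaskSequence

theorem not_dvd_X_of_vars_lt {p : BlockPoly} (hp : Prime p) {N : ℕ} (hN : ∀ v ∈ p.vars, v.1 < N)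
    {v : ℕ × Fin 7} (hv : N ≤ v.1) : ¬ p ∣ X v := by
  intro h
  have h2 := pow_dvd_pderiv (k := 1) (v := v)
    (pderiv_eq_zero_of_notMem_vars fun h => absurd (hN v h) (not_lt.2 hv)) (by simpa using h)
  rw [pderiv_X_self] at h2
  exact hp.not_isUnit (isUnit_of_dvd_one (by simpa using h2))

theorem not_pow_dvd_sub (hc : IsTaskSequence c) {p m : BlockPoly} {k N : ℕ} (hp : Prime p)
    (hk : k ≠ 0) (hN : ∀ v ∈ p.vars, v.1 < N) (hpS : ∀ s ∈ inverted c, ¬ p ∣ s)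
    (hJ : ∀ b, IsSmallProduct b → ¬ p ^ k ∣ b) (hpm : ¬ p ∣ m)
    (hm : m = 1 ∨ ∃ v, IsSmall v ∧ m = X v) {g h : BlockPoly} (hg : g ∈ inverted c)
    (hh : h ∈ inverted c) : ¬ p ^ k ∣ X (N, 6) * g - m * h := by
  have hpv : ∀ v : ℕ × Fin 7, N ≤ v.1 → pderiv v p = 0 := fun v hv =>
    pderiv_eq_zero_of_notMem_vars fun h => absurd (hN v h) (not_lt.2 hv)
  have hpd : ¬ p ∣ X (N, 6) := not_dvd_X_of_vars_lt hp hN le_rfl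
  have hmv : ∀ (n : ℕ) (i : Fin 7), i ≠ 0 → i ≠ 1 → pderiv (n, i) m = 0 := by
    rintro n i h0 h1
    rcases hm with rfl | ⟨w, hw, rfl⟩
    · exact pderiv_one
    · refine pderiv_X_eq_zero ?_
      rintro rfl
      exact hw.elim h0 h1
  have hm01 : ∀ n, pderiv (n, 0) m = 0 ∨ pderiv (n, 1) m = 0 := by
    intro n
    rcases hm with rfl | ⟨w, hw, rfl⟩
    · exact Or.inl pderiv_one
    · by_cases h : w = (n, 0)
      · right
        rw [h]
        exact pderiv_X_eq_zero (by simp)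
      · exact Or.inl (pderiv_X_eq_zero h)
  have hpk : ∀ {x : BlockPoly}, p ^ k ∣ x → p ∣ x := fun hx => (dvd_pow_self p hk).trans hx
  suffices H : ∀ n, N ≤ n → ∀ g ∈ stage c n, ∀ h ∈ stage c n, ¬ p ^ k ∣ X (N, 6) * g - m * h by
    obtain ⟨n₁, h₁⟩ := mem_inverted.1 hg
    obtain ⟨n₂, h₂⟩ := mem_inverted.1 hh
    exact H (N + n₁ + n₂) (by omega) g (stage_mono (by omega) h₁) h (stage_mono (by omega) h₂)
  intro n hn
  induction n, hn using Nat.le_induction with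
  | base =>
    -- Only the explicit factor X(N, 6) depends on that variable, so differentiation leaves p^k ∣ g.
    intro g hg h hh hdvd
    have h1 := pow_dvd_pderiv (hpv (N, 6) le_rfl) hdvd
    rw [map_sub, pderiv_mul, pderiv_mul, pderiv_X_self, hmv _ _ (by decide) (by decide),
      hc.pderiv_stage le_rfl g hg, hc.pderiv_stage le_rfl h hh, mul_zero, mul_zero, zero_mul,
      add_zero, add_zero, sub_zero, one_mul] at h1
    exact hpS g (mem_inverted.2 ⟨N, hg⟩) (hpk h1)
  | succ n hn ih =>
    have hpX : ∀ i, ¬ p ∣ X (n, i) := fun i => not_dvd_X_of_vars_lt hp hN hn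
    have hd : ∀ i, i ≠ 6 → pderiv (n, i) (X (N, 6) : BlockPoly) = 0 := fun i hi =>
      pderiv_X_eq_zero fun h => hi (Prod.ext_iff.1 h).2.symm
    have hle : ∀ {S : Submonoid BlockPoly}, S ≤ inverted c → ∀ g ∈ S, ¬ p ∣ g := fun hS g hg =>
      hpS g (hS hg)
    have hle0 : stage c n ≤ inverted c := fun f hf => mem_inverted.2 ⟨n, hf⟩
    have hle1 : stage c n ⊔ Submonoid.powers (unitA c n) ≤ inverted c :=
      sup_le hle0 ((Submonoid.powers_le).2 (unitA_mem n))
    have hle2 : stage c n ⊔ Submonoid.powers (unitA c n) ⊔ Submonoid.powers (unitB c n)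
        ≤ inverted c := sup_le hle1 ((Submonoid.powers_le).2 (unitB_mem n))
    have hfree : ∀ {S : Submonoid BlockPoly} {u : BlockPoly} {v : ℕ × Fin 7},
        (∀ g ∈ S, pderiv v g = 0) → pderiv v u = 0 →
        ∀ g ∈ S ⊔ Submonoid.powers u, pderiv v g = 0 := by
      intro S u v hS hu g hg
      obtain ⟨x, hx, _, ⟨i, rfl⟩, rfl⟩ := Submonoid.mem_sup.1 hg
      change pderiv v (x * u ^ i) = 0
      rw [pderiv_mul, pderiv_pow, hS x hx, hu, zero_mul, mul_zero, mul_zero, add_zero]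
    have hfree0 : ∀ i, ∀ g ∈ stage c n, pderiv (n, i) g = 0 := fun i => hc.pderiv_stage le_rfl
    have ha : ∀ i, pderiv (n, i) (c n).1 = 0 := fun i => hc.pderiv_fst le_rfl
    have hb : ∀ i, pderiv (n, i) (c n).2 = 0 := fun i => hc.pderiv_snd le_rfl
    have hX : ∀ i j, pderiv (n, j) (X (n, i) : BlockPoly) = if i = j then 1 else 0 := by
      intro i j
      split_ifs with hij
      · rw [hij, pderiv_X_self]
      · exact pderiv_X_eq_zero (by simpa using hij)
    have hfree1 : ∀ i, i ≠ 2 → i ≠ 3 → ∀ g ∈ stage c n ⊔ Submonoid.powers (unitA c n),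
        pderiv (n, i) g = 0 := by
      intro i h2 h3
      refine hfree (hfree0 i) ?_
      simp [unitA, ha, hb, hX, h2.symm, h3.symm]
    have hfree2 : ∀ g ∈ stage c n ⊔ Submonoid.powers (unitA c n) ⊔ Submonoid.powers (unitB c n),
        pderiv (n, 5) g = 0 := by
      refine hfree (hfree1 5 (by decide) (by decide)) ?_
      simp [unitB, hb, hX]
    have hA : ∀ g ∈ stage c n ⊔ Submonoid.powers (unitA c n),
        ∀ h ∈ stage c n ⊔ Submonoid.powers (unitA c n), ¬ p ^ k ∣ X (N, 6) * g - m * h := by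
      -- The derivatives of A in X₃ and X₂ are b and a, and p cannot divide both.
      by_cases hpb : p ^ k ∣ (c n).2
      · refine not_pow_dvd_sub_extend (v := (n, 2)) hp (hpv _ hn) (hd _ (by decide))
          (hmv _ _ (by decide) (by decide)) (hfree0 _) hpd hpm (hle hle0) (hpS _ (unitA_mem n)) ?_ ih
        have h1 : ¬ p ^ k ∣ (c n).1 := fun h => hc.not_dvd_both hp (hpk hpb) (hpk h)
        simpa [unitA, pderiv_mul, ha, hb, hX] using h1
      · refine not_pow_dvd_sub_extend (v := (n, 3)) hp (hpv _ hn) (hd _ (by decide))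
          (hmv _ _ (by decide) (by decide)) (hfree0 _) hpd hpm (hle hle0) (hpS _ (unitA_mem n)) ?_ ih
        simpa [unitA, pderiv_mul, ha, hb, hX] using hpb
    have hB : ∀ g ∈ stage c n ⊔ Submonoid.powers (unitA c n) ⊔ Submonoid.powers (unitB c n),
        ∀ h ∈ stage c n ⊔ Submonoid.powers (unitA c n) ⊔ Submonoid.powers (unitB c n),
          ¬ p ^ k ∣ X (N, 6) * g - m * h := by
      by_cases hpb : p ^ k ∣ (c n).2
      · have hXmul : ∀ i j, ¬ p ^ k ∣ X (n, i) * X (n, j) := fun i j h =>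
          (hp.dvd_or_dvd (hpk h)).elim (hpX i) (hpX j)
        -- Two small variables per block are needed here: m may be one of them, and the other is
        -- still fresh.
        rcases hm01 n with hmz | hmz
        · refine not_pow_dvd_sub_extend (v := (n, 0)) hp (hpv _ hn) (hd _ (by decide))
            hmz (hfree1 _ (by decide) (by decide)) hpd hpm (hle hle1) (hpS _ (unitB_mem n)) ?_ hA
          simpa [unitB, pderiv_mul, hb, hX] using hXmul 2 1
        · refine not_pow_dvd_sub_extend (v := (n, 1)) hp (hpv _ hn) (hd _ (by decide))
            hmz (hfree1 _ (by decide) (by decide)) hpd hpm (hle hle1) (hpS _ (unitB_mem n)) ?_ hA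
          simpa [unitB, pderiv_mul, hb, hX] using hXmul 2 0
      · refine not_pow_dvd_sub_extend (v := (n, 4)) hp (hpv _ hn) (hd _ (by decide))
          (hmv _ _ (by decide) (by decide)) (hfree1 _ (by decide) (by decide)) hpd hpm (hle hle1)
          (hpS _ (unitB_mem n)) ?_ hA
        simpa [unitB, pderiv_mul, hb, hX] using hpb
    by_cases hsmall : IsSmallProduct (c n).2
    · refine not_pow_dvd_sub_extend (v := (n, 5)) hp (hpv _ hn) (hd _ (by decide))
        (hmv _ _ (by decide) (by decide)) hfree2 hpd hpm (hle hle2)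
        (hpS _ (unitC_mem n)) ?_ hB
      rw [unitC, if_pos hsmall, map_add, pderiv_mul, ha, hb, pderiv_X_self]
      simpa using hJ _ hsmall
    · have h1 : unitC c n = 1 := if_neg hsmall
      rw [stage, h1, Submonoid.powers_one, sup_bot_eq]
      exact hB

end IsTaskSequence

open UniqueFactorizationMonoid

/-! ### Weights of multisets and the Euclidean size -/

section Weight

variable {α : Type*} [DecidableEq α] {P : α → Prop} [DecidablePred P]

/-- Weight `3` for every element, reduced by `2` once for every distinct element with property
`P`. -/
def multisetWeight (P : α → Prop) [DecidablePred P] (B : Multiset α) : ℕ :=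
  3 * B.card - 2 * (B.filter P).toFinset.card

theorem card_toFinset_filter_le (B : Multiset α) : (B.filter P).toFinset.card ≤ B.card :=
  (Multiset.toFinset_card_le _).trans (Multiset.card_le_card (Multiset.filter_le _ _))

/-- A first occurrence in one summand may become a repetition in the sum and lose its discount. -/
theorem multisetWeight_add_le (M B : Multiset α) :
    multisetWeight P M + multisetWeight P B ≤ multisetWeight P (M + B) := by
  have h1 := card_toFinset_filter_le (P := P) M
  have h2 := card_toFinset_filter_le (P := P) B
  have h3 : ((M + B).filter P).toFinset.card ≤
      (M.filter P).toFinset.card + (B.filter P).toFinset.card := by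
    rw [Multiset.filter_add, Multiset.toFinset_add]
    exact Finset.card_union_le _ _
  simp only [multisetWeight, Multiset.card_add]
  omega

theorem one_le_multisetWeight {B : Multiset α} (hB : B ≠ 0) : 1 ≤ multisetWeight P B := by
  have h1 := card_toFinset_filter_le (P := P) B
  have h2 := Multiset.card_pos.2 hB
  simp only [multisetWeight]
  omega

/-- An element without `P`, or the second copy of a repeated one, already counts 3. -/
theorem three_le_multisetWeight {B : Multiset α} (hB : ¬ (B.Nodup ∧ ∀ q ∈ B, P q)) :
    3 ≤ multisetWeight P B := by
  have h1 : (B.filter P).toFinset.card ≤ (B.filter P).card := Multiset.toFinset_card_le _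
  have h2 : (B.filter P).card ≤ B.card := Multiset.card_le_card (Multiset.filter_le _ _)
  simp only [multisetWeight]
  by_cases hP : ∀ q ∈ B, P q
  · have hnd : ¬ B.Nodup := fun h => hB ⟨h, hP⟩
    rw [Multiset.filter_eq_self.2 hP] at h1 ⊢
    have h3 : B.toFinset.card ≠ B.card := fun h => hnd (Multiset.toFinset_card_eq_card_iff_nodup.1 h)
    have h4 : B.toFinset.card ≠ 0 := by
      intro h
      rw [Finset.card_eq_zero, Multiset.toFinset_eq_empty] at h
      rw [h] at hnd
      exact hnd Multiset.nodup_zero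
    omega
  · have h3 : (B.filter P).card ≠ B.card := by
      intro h
      exact hP (Multiset.filter_eq_self.1
        (Multiset.eq_of_le_of_card_le (Multiset.filter_le _ _) h.ge))
    omega

theorem multisetWeight_add_pair {M : Multiset α} {x y : α} (hx : x ∉ M) (hy : y ∉ M) (hxy : x ≠ y)
    (hPx : P x) (hPy : P y) :
    multisetWeight P (M + ({x} + {y})) = multisetWeight P M + 2 := by
  have h1 := card_toFinset_filter_le (P := P) M
  have h2 : ((M + ({x} + {y})).filter P).toFinset = insert x (insert y (M.filter P).toFinset) := by
    ext z
    simp only [Multiset.mem_toFinset, Multiset.mem_filter, Multiset.mem_add,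
      Multiset.mem_singleton, Finset.mem_insert]
    grind
  have h3 : ((M + ({x} + {y})).filter P).toFinset.card = (M.filter P).toFinset.card + 2 := by
    rw [h2, Finset.card_insert_of_notMem, Finset.card_insert_of_notMem]
    · simp [hy]
    · simp [hx, hxy]
  simp only [multisetWeight, h3, Multiset.card_add, Multiset.card_singleton]
  omega

end Weight

noncomputable local instance : NormalizationMonoid BlockPoly :=
  (UniqueFactorizationMonoid.strongNormalizationMonoid (α := BlockPoly)).toNormalizationMonoid

/-- Associates of the small variables. -/
def IsSmallPrime (q : BlockPoly) : Prop := ∃ v, IsSmall v ∧ Associated q (X v)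

open Classical in
/-- The prime factors that are not inverted. -/
noncomputable def keptFactors (c : ℕ → BlockPoly × BlockPoly) (f : BlockPoly) :
    Multiset BlockPoly := (normalizedFactors f).filter (· ∉ inverted c)

open Classical in
/-- The Euclidean size of a polynomial: every prime factor that is not inverted counts `3`, except
that the first occurrence of a small prime counts `1`. -/
noncomputable def size (c : ℕ → BlockPoly × BlockPoly) (f : BlockPoly) : ℕ :=
  multisetWeight IsSmallPrime (keptFactors c f)

open Classical in
theorem keptFactors_mul {f g : BlockPoly} (hf : f ≠ 0) (hg : g ≠ 0) :
    keptFactors c (f * g) = keptFactors c f + keptFactors c g := by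
  rw [keptFactors, normalizedFactors_mul hf hg, Multiset.filter_add]
  rfl

namespace IsTaskSequence

open Classical in
theorem keptFactors_eq_zero (hc : IsTaskSequence c) {s : BlockPoly} (hs : s ∈ inverted c) :
    keptFactors c s = 0 := by
  rw [keptFactors, Multiset.filter_eq_nil]
  exact fun q hq hqs => hqs (hc.mem_inverted_of_dvd hs q (dvd_of_mem_normalizedFactors hq))

open Classical in
theorem keptFactors_small (hc : IsTaskSequence c) {v : ℕ × Fin 7} (hv : IsSmall v) :
    keptFactors c (X v) = {normalize (X v)} := by
  rw [keptFactors, normalizedFactors_irreducible (X_prime (i := v) (R := ℚ)).irreducible,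
    Multiset.filter_eq_self]
  intro q hq hqs
  rw [Multiset.mem_singleton] at hq
  subst hq
  exact hc.small_not_dvd hv hqs (dvd_normalize_iff.2 dvd_rfl)

theorem size_mul_mem (hc : IsTaskSequence c) {f s : BlockPoly} (hf : f ≠ 0) (hs : s ∈ inverted c) :
    size c (f * s) = size c f := by
  rw [size, keptFactors_mul hf (hc.ne_zero_of_mem hs), hc.keptFactors_eq_zero hs, add_zero]
  rfl

open Classical in
theorem keptFactors_ne_zero {f : BlockPoly} (hf : f ≠ 0)
    (hfs : f ∉ inverted c) : keptFactors c f ≠ 0 := by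
  intro h
  rw [keptFactors, Multiset.filter_eq_nil] at h
  obtain ⟨ε, hε⟩ := prod_normalizedFactors hf
  apply hfs
  rw [← hε]
  exact mul_mem (Submonoid.multiset_prod_mem _ _ fun q hq => not_not.1 (h q hq))
    (isUnit_mem ε.isUnit)

open Classical in
theorem size_lt_size_mul {d b : BlockPoly} (hd : d ≠ 0) (hb : b ≠ 0)
    (hbs : b ∉ inverted c) : size c d < size c (d * b) := by
  have h1 := one_le_multisetWeight (P := IsSmallPrime) (keptFactors_ne_zero hb hbs)
  have h2 := multisetWeight_add_le (P := IsSmallPrime) (keptFactors c d) (keptFactors c b)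
  rw [← keptFactors_mul hd hb] at h2
  simp only [size]
  omega

open Classical in
theorem size_add_three_le {d b : BlockPoly} (hd : d ≠ 0) (hb : b ≠ 0)
    (hkept : ¬ ((keptFactors c b).Nodup ∧ ∀ q ∈ keptFactors c b, IsSmallPrime q)) :
    size c d + 3 ≤ size c (d * b) := by
  have h1 := three_le_multisetWeight (P := IsSmallPrime) hkept
  have h2 := multisetWeight_add_le (P := IsSmallPrime) (keptFactors c d) (keptFactors c b)
  rw [← keptFactors_mul hd hb] at h2
  simp only [size]
  omega

open Classical in
theorem size_mul_small_mul_small (hc : IsTaskSequence c) {d : BlockPoly} (hd : d ≠ 0)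
    {v w : ℕ × Fin 7} (hv : IsSmall v) (hw : IsSmall w) (hvw : v ≠ w) (hvd : v ∉ d.vars)
    (hwd : w ∉ d.vars) : size c (d * (X v * X w)) = size c d + 2 := by
  have hnot : ∀ v : ℕ × Fin 7, v ∉ d.vars → normalize (X v) ∉ keptFactors c d := by
    intro v hv h
    rw [keptFactors, Multiset.mem_filter] at h
    exact not_X_dvd hd hv (normalize_dvd_iff.1 (dvd_of_mem_normalizedFactors h.1))
  have hsmall : ∀ {v : ℕ × Fin 7}, IsSmall v → IsSmallPrime (normalize (X v)) := fun hv =>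
    ⟨_, hv, normalize_associated _⟩
  rw [size, keptFactors_mul hd (mul_ne_zero (X_ne_zero v) (X_ne_zero w)),
    keptFactors_mul (X_ne_zero v) (X_ne_zero w), hc.keptFactors_small hv, hc.keptFactors_small hw]
  refine multisetWeight_add_pair (hnot v hvd) (hnot w hwd) (fun h => hvw ?_) (hsmall hv) (hsmall hw)
  have h1 : (X v : BlockPoly) ∣ X w := by
    rw [← dvd_normalize_iff, ← h]
    exact dvd_normalize_iff.2 dvd_rfl
  exact X_dvd_X.1 h1

theorem exists_prod_associated (B : Multiset BlockPoly) (hB : B.Nodup)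
    (hnorm : ∀ q ∈ B, normalize q = q) (hsmall : ∀ q ∈ B, IsSmallPrime q) :
    ∃ J : Finset (ℕ × Fin 7), (∀ v ∈ J, IsSmall v ∧ ∃ q ∈ B, Associated q (X v)) ∧
      Associated (∏ v ∈ J, X v) B.prod := by
  classical
  induction B using Multiset.induction_on with
  | empty => exact ⟨∅, by simp, by simp⟩
  | cons q B ih =>
    rw [Multiset.nodup_cons] at hB
    obtain ⟨J, hJ, hJB⟩ := ih hB.2 (fun r hr => hnorm r (Multiset.mem_cons_of_mem hr))
      (fun r hr => hsmall r (Multiset.mem_cons_of_mem hr))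
    obtain ⟨v, hv, hqv⟩ := hsmall q (Multiset.mem_cons_self q B)
    have hvJ : v ∉ J := by
      intro h
      obtain ⟨-, r, hr, hrv⟩ := hJ v h
      have h1 := normalize_eq_normalize (hqv.trans hrv.symm).dvd (hqv.trans hrv.symm).symm.dvd
      rw [hnorm q (Multiset.mem_cons_self q B), hnorm r (Multiset.mem_cons_of_mem hr)] at h1
      exact hB.1 (h1 ▸ hr)
    refine ⟨insert v J, ?_, ?_⟩
    · intro w hw
      rcases Finset.mem_insert.1 hw with rfl | hw
      · exact ⟨hv, q, Multiset.mem_cons_self q B, hqv⟩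
      · obtain ⟨h1, r, hr, hrw⟩ := hJ w hw
        exact ⟨h1, r, Multiset.mem_cons_of_mem hr, hrw⟩
    · rw [Finset.prod_insert hvJ, Multiset.prod_cons]
      exact hqv.symm.mul_mul hJB

open Classical in
theorem exists_isSmallProduct {b : BlockPoly} (hb : b ≠ 0) (hnd : (keptFactors c b).Nodup)
    (hsmall : ∀ q ∈ keptFactors c b, IsSmallPrime q) :
    ∃ s ∈ inverted c, ∃ b', IsSmallProduct b' ∧ b = s * b' := by
  obtain ⟨J, hJ, hJB⟩ := exists_prod_associated (keptFactors c b) hnd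
    (fun q hq => normalize_normalized_factor q (Multiset.mem_filter.1 hq).1) hsmall
  have hsplit : (keptFactors c b).prod *
      ((normalizedFactors b).filter fun q => ¬ q ∉ inverted c).prod = (normalizedFactors b).prod := by
    rw [← Multiset.prod_add, keptFactors, Multiset.filter_add_not]
  have hassoc : Associated ((∏ v ∈ J, X v) *
      ((normalizedFactors b).filter fun q => ¬ q ∉ inverted c).prod) b := by
    refine Associated.trans ?_ (prod_normalizedFactors hb)
    rw [← hsplit]
    exact hJB.mul_right _
  obtain ⟨ε, hε⟩ := hassoc
  refine ⟨((normalizedFactors b).filter fun q => ¬ q ∉ inverted c).prod * ε,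
    mul_mem (Submonoid.multiset_prod_mem _ _ fun q hq => not_not.1 (Multiset.mem_filter.1 hq).2)
      (isUnit_mem ε.isUnit), _, ⟨J, fun v hv => (hJ v hv).1, rfl⟩, ?_⟩
  exact hε.symm.trans (by ring)

end IsTaskSequence

/-! ### The localization and its division algorithm -/

/-- The Euclidean domain without multiplicative norms. -/
abbrev Loc (c : ℕ → BlockPoly × BlockPoly) : Type := Localization (inverted c)

/-- The canonical map to the localization. -/
noncomputable abbrev toLoc (c : ℕ → BlockPoly × BlockPoly) : BlockPoly →+* Loc c :=
  algebraMap BlockPoly (Loc c)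

theorem isUnit_toLoc {s : BlockPoly} (hs : s ∈ inverted c) : IsUnit (toLoc c s) :=
  IsLocalization.map_units (Loc c) (⟨s, hs⟩ : inverted c)

theorem exists_mul_toLoc (r : Loc c) : ∃ f, ∃ s ∈ inverted c, r * toLoc c s = toLoc c f := by
  obtain ⟨⟨f, s⟩, h⟩ := IsLocalization.surj (inverted c) r
  exact ⟨f, s, s.2, h⟩

/-- The Euclidean size of an element of the localization. -/
noncomputable def locSize (c : ℕ → BlockPoly × BlockPoly) (r : Loc c) : ℕ :=
  size c (IsLocalization.sec (inverted c) r).1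

namespace IsTaskSequence

theorem inverted_le (hc : IsTaskSequence c) : inverted c ≤ nonZeroDivisors BlockPoly :=
  fun _ hs => mem_nonZeroDivisors_of_ne_zero (hc.ne_zero_of_mem hs)

theorem isDomain (hc : IsTaskSequence c) : IsDomain (Loc c) :=
  IsLocalization.isDomain_localization hc.inverted_le

theorem toLoc_injective (hc : IsTaskSequence c) : Function.Injective (toLoc c) :=
  IsLocalization.injective (Loc c) hc.inverted_le

theorem toLoc_ne_zero (hc : IsTaskSequence c) {f : BlockPoly} (hf : f ≠ 0) : toLoc c f ≠ 0 :=
  fun h => hf (hc.toLoc_injective (h.trans (map_zero _).symm))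

theorem exists_dvd_mul_of_toLoc_dvd (hc : IsTaskSequence c) {a f : BlockPoly}
    (h : toLoc c a ∣ toLoc c f) : ∃ s ∈ inverted c, a ∣ f * s := by
  obtain ⟨r, hr⟩ := h
  obtain ⟨g, s, hs, hg⟩ := exists_mul_toLoc r
  refine ⟨s, hs, g, hc.toLoc_injective ?_⟩
  rw [map_mul, map_mul, hr, mul_assoc, hg]

theorem mem_of_isUnit_toLoc (hc : IsTaskSequence c) {f : BlockPoly} (h : IsUnit (toLoc c f)) :
    f ∈ inverted c := by
  obtain ⟨s, hs, hfs⟩ := (IsLocalization.algebraMap_isUnit_iff (inverted c)).1 h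
  exact hc.mem_inverted_of_dvd hs f hfs

theorem exists_mul_toLoc_of_isUnit (hc : IsTaskSequence c) {ε : Loc c} (hε : IsUnit ε) :
    ∃ f ∈ inverted c, ∃ s ∈ inverted c, ε * toLoc c s = toLoc c f := by
  obtain ⟨f, s, hs, h⟩ := exists_mul_toLoc ε
  refine ⟨f, hc.mem_of_isUnit_toLoc ?_, s, hs, h⟩
  rw [← h]
  exact hε.mul (isUnit_toLoc hs)

/-- Numerators of associates agree up to inverted factors, which `size` ignores, so the choice made
by `IsLocalization.sec` is immaterial. -/
theorem locSize_eq (hc : IsTaskSequence c) {f : BlockPoly} (hf : f ≠ 0) {r ε : Loc c}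
    (hε : IsUnit ε) (hr : r = toLoc c f * ε) : locSize c r = size c f := by
  have hspec := IsLocalization.sec_spec (inverted c) r
  have hsmem := (IsLocalization.sec (inverted c) r).2.2
  rw [locSize]
  generalize (IsLocalization.sec (inverted c) r).1 = f₁ at *
  generalize ((IsLocalization.sec (inverted c) r).2 : BlockPoly) = s₁ at *
  obtain ⟨f₂, hf₂, s₂, hs₂, h₂⟩ := hc.exists_mul_toLoc_of_isUnit hε
  have h : f * (f₂ * s₁) = f₁ * s₂ := by
    apply hc.toLoc_injective
    rw [map_mul, map_mul, map_mul, ← h₂]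
    change _ = algebraMap BlockPoly (Loc c) f₁ * _
    rw [← hspec, hr]
    ring
  have hf₁ : f₁ ≠ 0 := by
    rintro rfl
    rw [zero_mul] at h
    exact mul_ne_zero hf (hc.ne_zero_of_mem (mul_mem hf₂ hsmem)) h
  rw [← hc.size_mul_mem hf₁ hs₂, ← h, hc.size_mul_mem hf (mul_mem hf₂ hsmem)]

/-- Division with remainder for relatively prime polynomials, with a remainder that keeps the size
small after multiplication by any given `d`. -/
theorem exists_small_remainder (hc : IsTaskSequence c) {a b d : BlockPoly} (hb : b ≠ 0)
    (hd : d ≠ 0) (hab : IsRelPrime a b) (hbs : b ∉ inverted c) :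
    ∃ (q ε : Loc c) (e : BlockPoly), IsUnit ε ∧ e ≠ 0 ∧
      toLoc c a - q * toLoc c b = toLoc c e * ε ∧ size c (d * e) < size c (d * b) := by
  classical
  by_cases hkept : (keptFactors c b).Nodup ∧ ∀ q ∈ keptFactors c b, IsSmallPrime q
  · obtain ⟨s, hs, b', hb', rfl⟩ := exists_isSmallProduct hb hkept.1 hkept.2
    obtain ⟨n, -, hn⟩ := hc.exhaustive a b' (right_ne_zero_of_mul hb) hab.of_mul_right_right 0
    have hu : unitC c n = b' * X (n, 5) + a := by
      rw [unitC, hn, if_pos hb']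
    obtain ⟨t, ht⟩ := (isUnit_toLoc hs).exists_right_inv
    refine ⟨-(toLoc c (X (n, 5)) * t), toLoc c (unitC c n), 1, isUnit_toLoc (unitC_mem n),
      one_ne_zero, ?_, ?_⟩
    · rw [hu, map_one, map_add, map_mul, map_mul]
      linear_combination toLoc c b' * toLoc c (X (n, 5)) * ht
    · rw [mul_one]
      exact size_lt_size_mul hd hb hbs
  · obtain ⟨N, hN⟩ := exists_vars_lt d
    obtain ⟨n, hNn, hn⟩ := hc.exhaustive a b hb hab N
    have hnd : ∀ i, (n, i) ∉ d.vars := fun i h => absurd (hN _ h) (not_lt.2 hNn)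
    obtain ⟨t, ht⟩ := (isUnit_toLoc (unitB_mem (c := c) n)).exists_right_inv
    -- From aB - X₀X₁A = b(aX₄ - X₀X₁X₃), divided by B.
    refine ⟨(toLoc c a * toLoc c (X (n, 4)) - toLoc c (X (n, 3)) * toLoc c (X (n, 0) * X (n, 1))) * t,
      toLoc c (unitA c n) * t, X (n, 0) * X (n, 1), ?_, mul_ne_zero (X_ne_zero _) (X_ne_zero _),
      ?_, ?_⟩
    · exact (isUnit_toLoc (unitA_mem n)).mul (IsUnit.of_mul_eq_one _ ((mul_comm _ _).trans ht))
    · have hA : toLoc c (unitA c n) =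
          toLoc c b * toLoc c (X (n, 3)) + toLoc c a * toLoc c (X (n, 2)) := by
        rw [unitA, hn, map_add, map_mul, map_mul]
      have hB : toLoc c (unitB c n) = toLoc c b * toLoc c (X (n, 4)) +
          toLoc c (X (n, 0) * X (n, 1)) * toLoc c (X (n, 2)) := by
        rw [unitB, hn, map_add, map_mul, map_mul]
      rw [hB] at ht
      rw [hA]
      linear_combination (-toLoc c a) * ht
    · have h3 := size_add_three_le hd hb hkept
      rw [hc.size_mul_small_mul_small hd (Or.inl rfl) (Or.inr rfl) (by simp) (hnd 0) (hnd 1)]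
      omega

theorem isEuclideanNorm_locSize (hc : IsTaskSequence c) :
    IsEuclideanNorm fun r : {r : Loc c // r ≠ 0} => locSize c r := by
  have := hc.isDomain
  intro α β hβ hβα
  obtain ⟨f, s, hs, hf⟩ := exists_mul_toLoc α
  obtain ⟨g, t, ht, hg⟩ := exists_mul_toLoc β
  have hg0 : g ≠ 0 := by
    rintro rfl
    rw [map_zero] at hg
    exact mul_ne_zero hβ (isUnit_toLoc ht).ne_zero hg
  obtain ⟨a, b, d, hab, rfl, rfl⟩ := UniqueFactorizationMonoid.exists_reduced_factors' f g hg0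
  have hb := right_ne_zero_of_mul hg0
  have hd := left_ne_zero_of_mul hg0
  obtain ⟨s', hs'⟩ := (isUnit_toLoc hs).exists_right_inv
  obtain ⟨t', ht'⟩ := (isUnit_toLoc ht).exists_right_inv
  have hs'u : IsUnit s' := IsUnit.of_mul_eq_one _ ((mul_comm _ _).trans hs')
  have ht'u : IsUnit t' := IsUnit.of_mul_eq_one _ ((mul_comm _ _).trans ht')
  rw [map_mul] at hf hg
  have hα : α = toLoc c d * toLoc c a * s' := by linear_combination s' * hf - α * hs'
  have hβ' : β = toLoc c d * toLoc c b * t' := by linear_combination t' * hg - β * ht'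
  have hbs : b ∉ inverted c := by
    intro hbs
    obtain ⟨k, hk⟩ := (isUnit_toLoc hbs).exists_right_inv
    refine hβα ⟨toLoc c t * k * toLoc c a * s', ?_⟩
    rw [hα, hβ']
    linear_combination (-toLoc c d * toLoc c a * s' * toLoc c b * k) * ht' -
      toLoc c d * toLoc c a * s' * hk
  obtain ⟨q, ε, e, hε, he, heq, hlt⟩ := hc.exists_small_remainder hb hd hab hbs
  have hrem : α - q * s' * toLoc c t * β = toLoc c (d * e) * (ε * s') := by
    rw [hα, hβ', map_mul]
    linear_combination toLoc c d * s' * heq - q * s' * toLoc c d * toLoc c b * ht'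
  have hunit := hε.mul hs'u
  refine ⟨q * s' * toLoc c t, ?_, ?_⟩
  · rw [hrem]
    exact mul_ne_zero (hc.toLoc_ne_zero (mul_ne_zero hd he)) hunit.ne_zero
  · change locSize c (α - q * s' * toLoc c t * β) < locSize c β
    rw [hc.locSize_eq (mul_ne_zero hd he) hunit hrem,
      hc.locSize_eq hg0 ht'u (by rw [map_mul]; exact hβ')]
    exact hlt

end IsTaskSequence

/-! ### Avoided residue classes in the localization -/

/-- The associates of the small primes in the localization. -/
def smallPrimes (c : ℕ → BlockPoly × BlockPoly) : Set (Loc c) :=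
  {r | ∃ v, IsSmall v ∧ ∃ ε, IsUnit ε ∧ r = toLoc c (X v) * ε}

theorem exists_prime_dvd {f : BlockPoly} (hf : f ≠ 0) (hfs : f ∉ inverted c) :
    ∃ p, Prime p ∧ p ∣ f ∧ p ∉ inverted c := by
  by_contra! h
  obtain ⟨ε, hε⟩ := (UniqueFactorizationMonoid.factors_prod hf)
  apply hfs
  rw [← hε]
  refine mul_mem (Submonoid.multiset_prod_mem _ _ fun q hq => h q ?_ ?_) (isUnit_mem ε.isUnit)
  · exact UniqueFactorizationMonoid.prime_of_factor q hq
  · exact UniqueFactorizationMonoid.dvd_of_mem_factors hq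

theorem sq_not_dvd_isSmallProduct (v : ℕ × Fin 7) {b : BlockPoly} (hb : IsSmallProduct b) :
    ¬ X v ^ 2 ∣ b := by
  classical
  obtain ⟨J, -, rfl⟩ := hb
  have hX : ∀ K : Finset (ℕ × Fin 7), X v ∣ ∏ w ∈ K, (X w : BlockPoly) → v ∈ K := by
    intro K hK
    obtain ⟨w, hw, hvw⟩ := (X_prime (i := v) (R := ℚ)).exists_mem_finset_dvd hK
    rwa [X_dvd_X.1 hvw]
  intro h
  have hv := hX J ((dvd_pow_self _ two_ne_zero).trans h)
  rw [← Finset.mul_prod_erase J _ hv, sq] at h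
  exact Finset.notMem_erase v J (hX _ ((mul_dvd_mul_iff_left (X_ne_zero v)).1 h))

namespace IsTaskSequence

theorem exists_avoided_class (hc : IsTaskSequence c) {p : BlockPoly} {k : ℕ} (hp : Prime p)
    (hk : k ≠ 0) (hpS : ∀ s ∈ inverted c, ¬ p ∣ s) (hJ : ∀ b, IsSmallProduct b → ¬ p ^ k ∣ b) :
    ∃ a : Loc c, ∀ r, toLoc c (p ^ k) ∣ a - r → r ≠ 0 ∧ ¬ IsUnit r ∧ r ∉ smallPrimes c := by
  obtain ⟨N, hN⟩ := exists_vars_lt p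
  have hpX : ¬ p ∣ X (N, 6) := not_dvd_X_of_vars_lt hp hN le_rfl
  have key : ∀ (m : BlockPoly) (ε : Loc c), (m = 1 ∨ ∃ v, IsSmall v ∧ m = X v) → IsUnit ε →
      ¬ toLoc c (p ^ k) ∣ toLoc c (X (N, 6)) - toLoc c m * ε := by
    intro m ε hm hε hdvd
    obtain ⟨f, hf, s, hs, hfs⟩ := hc.exists_mul_toLoc_of_isUnit hε
    have h1 : toLoc c (p ^ k) ∣ toLoc c (X (N, 6) * s - m * f) := by
      have h2 := hdvd.mul_right (toLoc c s)
      rw [sub_mul, mul_assoc, hfs] at h2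
      rwa [map_sub, map_mul, map_mul]
    obtain ⟨t, ht, h2⟩ := hc.exists_dvd_mul_of_toLoc_dvd h1
    rw [mul_comm] at h2
    have h3 := hp.pow_dvd_of_dvd_mul_left k (hpS t ht) h2
    -- This can happen when p is itself small; reduction modulo p then suffices.
    by_cases hpm : p ∣ m
    · have h4 : p ∣ X (N, 6) * s :=
        (dvd_sub_left (hpm.mul_right f)).1 ((dvd_pow_self p hk).trans h3)
      exact (hp.dvd_or_dvd h4).elim hpX (hpS s hs)
    · exact hc.not_pow_dvd_sub hp hk hN hpS hJ hpm hm hs hf h3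
  refine ⟨toLoc c (X (N, 6)), fun r hr => ⟨?_, ?_, ?_⟩⟩
  · rintro rfl
    rw [sub_zero] at hr
    obtain ⟨t, ht, h2⟩ := hc.exists_dvd_mul_of_toLoc_dvd hr
    exact (hp.dvd_or_dvd ((dvd_pow_self p hk).trans h2)).elim hpX (hpS t ht)
  · intro hu
    refine key 1 r (Or.inl rfl) hu ?_
    rwa [map_one, one_mul]
  · rintro ⟨v, hv, ε, hε, rfl⟩
    exact key (X v) ε (Or.inr ⟨v, hv, rfl⟩) hε hr

theorem not_isUnit_toLoc_small (hc : IsTaskSequence c) {v : ℕ × Fin 7} (hv : IsSmall v) :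
    ¬ IsUnit (toLoc c (X v)) := fun h =>
  hc.small_not_dvd hv (hc.mem_of_isUnit_toLoc h) dvd_rfl

/-- Avoidance passes to multiples of the modulus. A non-small irreducible gives a prime with k = 1,
the square of a small prime gives k = 2. -/
theorem exists_avoided_class_of_irreducible_or_sq (hc : IsTaskSequence c) (b : Loc c)
    (hb : (Irreducible b ∧ b ∉ smallPrimes c) ∨ ∃ w ∈ smallPrimes c, b = w ^ 2) :
    ∃ a, ∀ r, b ∣ a - r → r ≠ 0 ∧ ¬ IsUnit r ∧ r ∉ smallPrimes c := by
  have := hc.isDomain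
  suffices ∃ (p : BlockPoly) (k : ℕ), Prime p ∧ k ≠ 0 ∧ (∀ s ∈ inverted c, ¬ p ∣ s) ∧
      (∀ b, IsSmallProduct b → ¬ p ^ k ∣ b) ∧ toLoc c (p ^ k) ∣ b by
    obtain ⟨p, k, hp, hk, hpS, hJ, hpb⟩ := this
    obtain ⟨a, ha⟩ := hc.exists_avoided_class hp hk hpS hJ
    exact ⟨a, fun r hr => ha r (hpb.trans hr)⟩
  rcases hb with ⟨hirr, hbW⟩ | ⟨_, ⟨v, hv, ε, hε, rfl⟩, rfl⟩
  · obtain ⟨f, s, hs, hf⟩ := exists_mul_toLoc b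
    have hf0 : f ≠ 0 := by
      rintro rfl
      rw [map_zero] at hf
      exact mul_ne_zero hirr.ne_zero (isUnit_toLoc hs).ne_zero hf
    have hfS : f ∉ inverted c := by
      intro hfS
      have h1 := isUnit_toLoc hfS
      rw [← hf] at h1
      exact hirr.not_isUnit (isUnit_of_mul_isUnit_left h1)
    obtain ⟨p, hp, hpf, hpS⟩ := exists_prime_dvd hf0 hfS
    have hpb : toLoc c p ∣ b := by
      have h1 : toLoc c p ∣ b * toLoc c s := by
        rw [hf]
        exact map_dvd (toLoc c) hpf
      exact (isUnit_toLoc hs).dvd_mul_right.1 h1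
    refine ⟨p, 1, hp, one_ne_zero, fun s hs hps => hpS (hc.mem_inverted_of_dvd hs p hps), ?_, ?_⟩
    · rintro _ ⟨J, hJ, rfl⟩ hdvd
      rw [pow_one] at hdvd
      obtain ⟨v, hvJ, hpv⟩ := hp.exists_mem_finset_dvd hdvd
      have hassoc := hp.associated_of_dvd X_prime hpv
      have hvb : toLoc c (X v) ∣ b := (map_dvd (toLoc c) hassoc.symm.dvd).trans hpb
      obtain ⟨ε, hε⟩ := hvb
      refine hbW ⟨v, hJ v hvJ, ε, ?_, hε⟩
      exact (hirr.isUnit_or_isUnit hε).resolve_left (hc.not_isUnit_toLoc_small (hJ v hvJ))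
    · rwa [pow_one]
  · refine ⟨X v, 2, X_prime, two_ne_zero, fun s hs => hc.small_not_dvd hv hs,
      fun b hb => sq_not_dvd_isSmallProduct v hb, ?_⟩
    rw [map_pow, mul_pow]
    exact dvd_mul_right _ _

end IsTaskSequence

end BlockPoly

theorem theorem1p3 :
    ∃ (R : Type) (_ : CommRing R) (_ : IsDomain R),
      (∃ φ : {r : R // r ≠ 0} → ℕ, IsEuclideanNorm φ) ∧
      (∀ (M : Type v) [Monoid M] [LinearOrder M],
        (∀ a b c : M, a ≤ b → a * c ≤ b * c) →
          ¬ ∃ ψ : {r : R // r ≠ 0} → M, IsMultiplicativeEuclideanNorm ψ) ∧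
      (¬ ∃ ψ : {r : R // r ≠ 0} → ℝ, IsMultiplicativeEuclideanNorm ψ) := by
  obtain ⟨c, hc⟩ := BlockPoly.exists_isTaskSequence
  have hfield : ∃ t : BlockPoly.Loc c, t ≠ 0 ∧ ¬ IsUnit t :=
    ⟨_, hc.toLoc_ne_zero (MvPolynomial.X_ne_zero (0, 0)), hc.not_isUnit_toLoc_small (Or.inl rfl)⟩
  refine ⟨BlockPoly.Loc c, inferInstance, hc.isDomain, ⟨_, hc.isEuclideanNorm_locSize⟩, ?_, ?_⟩
  · rintro M _ _ hM ⟨ψ, hψ⟩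
    have := hc.isDomain
    exact hψ.false_of_avoided_classes hM (BlockPoly.smallPrimes c) hfield
      hc.exists_avoided_class_of_irreducible_or_sq
  · rintro ⟨ψ, hψ⟩
    have := hc.isDomain
    exact hψ.real_false_of_avoided_classes (BlockPoly.smallPrimes c) hfield
      hc.exists_avoided_class_of_irreducible_or_sq
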